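/- Let $\mathrm{FI}$ be the category of finite sets and injections. An FI-module is a functor $W\colon \mathrm{FI}\to \mathbb{Z}\text{-Mod}$, $T\mapsto W_T$; put $W_n:=W_{\{1,\dots,n\}}$. Its degree $\deg W\in\{-\infty\}\cup\mathbb{N}\cup\{\infty\}$ is the least $k$ such that $W_n=0$ for all $n\in\mathbb{N}$ with $n>k$. Let $H_0\colon \mathrm{FI}\text{-Mod}\to\mathrm{FI}\text{-Mod}$ be the right exact functor $$H_0(W)_T = W_T\,/\,\operatorname{span}\bigl(\operatorname{im}(f_*\colon W_S\to W_T)\ \big|\ f\colon S\hookrightarrow T,\ |S|<|T|\bigr),$$ and let $H_1$ be its first left derived functor. **Theorem.** Let $W$ be an arbitrary FI-module and let $N:=\max\bigl(\deg H_0(W),\deg H_1(W)\bigr)\in\{-\infty\}\cup\mathbb{N}\cup\{\infty\}$. Then for every finite set $T$, $$W_T=\operatorname*{colim}_{S\subset T,\ |S|\le N} W_S,$$ that is, the maps $W_S\to W_T$ induced by the inclusions $S\subset T$ exhibit $W_T$ as the colimit of the groups $W_S$ over the poset, under inclusion, of the subsets $S\subset T$ with $|S|\le N$. Moreover, $N$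 is the smallest element of $\{-\infty\}\cup\mathbb{N}\cup\{\infty\}$ with this property: if $K\in\{-\infty\}\cup\mathbb{N}\cup\{\infty\}$ is such that for every finite set $T$ the maps $W_S\to W_T$ exhibit $W_T$ as the colimit of the $W_S$ over the subsets $S\subset T$ with $|S|\le K$, then $N\le K$. -/

import Mathlib

open CategoryTheory CategoryTheory.Limits

universe u v

/-- Objects of the category `FI`: finite sets. -/
structure FI : Type (u + 1) where
  carrier : Type u
  [finite : Finite carrier]

namespace FI

attribute [instance] FI.finite

/-- Morphisms of `FI`: injections. -/
instance : Category.{u} FI.{u} where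
  Hom S T := S.carrier ↪ T.carrier
  id S := Function.Embedding.refl S.carrier
  comp f g := Function.Embedding.trans f g

instance (S T : FI.{u}) : Finite (S ⟶ T) :=
  inferInstanceAs (Finite (S.carrier ↪ T.carrier))

/-- The number of elements of a finite set. -/
noncomputable def card (T : FI.{u}) : ℕ := Nat.card T.carrier

/-- The finite set with `n` elements `0, …, n - 1`. -/
def std (n : ℕ) : FI.{u} := ⟨ULift.{u} (Fin n)⟩

lemma card_le_of_hom {S T : FI.{u}} (f : S ⟶ T) : S.card ≤ T.card :=
  Nat.card_le_card_of_injective _ (Function.Embedding.injective f)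

/-- Every finite set is isomorphic to a standard one. -/
lemma nonempty_iso_std (T : FI.{u}) : Nonempty (std.{u} T.card ≅ T) := by
  let e : ULift.{u} (Fin T.card) ≃ T.carrier :=
    Equiv.ulift.trans (Finite.equivFin T.carrier).symm
  refine ⟨⟨e.toEmbedding, e.symm.toEmbedding, ?_, ?_⟩⟩
  · exact Function.Embedding.ext fun x => e.symm_apply_apply x
  · exact Function.Embedding.ext fun x => e.apply_symm_apply x

end FI

/-- `FI`-modules: functors from `FI` to abelian groups. -/
abbrev FIMod := FI.{u} ⥤ ModuleCat.{v} ℤ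

namespace FIMod

/-- The degree of an `FI`-module, an element of `{-∞} ∪ ℕ ∪ {∞}`. -/
noncomputable def deg (W : FIMod.{u, v}) : WithBot ℕ∞ :=
  sInf {k : WithBot ℕ∞ | ∀ n : ℕ, k < (n : WithBot ℕ∞) → IsZero (W.obj (FI.std n))}

/-- The span in `W_T` of the images of all maps `W_S → W_T` induced by injections `S → T`
with `|S| < |T|`. -/
def decomposables (W : FIMod.{u, v}) (T : FI.{u}) : Submodule ℤ (W.obj T) :=
  ⨆ (S : FI.{u}) (f : S ⟶ T) (_ : S.card < T.card), LinearMap.range (W.map f).hom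

lemma decomposables_le_comap_map (W : FIMod.{u, v}) {T T' : FI.{u}} (g : T ⟶ T') :
    W.decomposables T ≤ (W.decomposables T').comap (W.map g).hom := by
  refine iSup_le fun S => iSup_le fun f => iSup_le fun h => ?_
  rintro _ ⟨x, rfl⟩
  have h' : S.card < T'.card := h.trans_le (FI.card_le_of_hom g)
  have hx : (W.map (f ≫ g)).hom x ∈ W.decomposables T' :=
    Submodule.mem_iSup_of_mem S (Submodule.mem_iSup_of_mem (f ≫ g)
      (Submodule.mem_iSup_of_mem h' ⟨x, rfl⟩))
  simpa using hx

lemma decomposables_le_comap_app {V W : FIMod.{u, v}} (φ : V ⟶ W) (T : FI.{u}) :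
    V.decomposables T ≤ (W.decomposables T).comap (φ.app T).hom := by
  refine iSup_le fun S => iSup_le fun f => iSup_le fun h => ?_
  rintro _ ⟨x, rfl⟩
  have hx : (W.map f).hom ((φ.app S).hom x) ∈ W.decomposables T :=
    Submodule.mem_iSup_of_mem S (Submodule.mem_iSup_of_mem f
      (Submodule.mem_iSup_of_mem h ⟨_, rfl⟩))
  have e : (φ.app T).hom ((V.map f).hom x) = (W.map f).hom ((φ.app S).hom x) :=
    NatTrans.naturality_apply φ f x
  rw [Submodule.mem_comap, e]
  exact hx

/-- The abelian group `H₀(W)_T`, the quotient of `W_T` by the images of all maps `W_S → W_T`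
with `|S| < |T|`. -/
abbrev indecomposables (W : FIMod.{u, v}) (T : FI.{u}) : ModuleCat.{v} ℤ :=
  ModuleCat.of ℤ (W.obj T ⧸ W.decomposables T)

/-- The map `H₀(W)_T → H₀(W)_T'` induced by an injection `T → T'`. -/
def indecomposablesMap (W : FIMod.{u, v}) {T T' : FI.{u}} (g : T ⟶ T') :
    W.indecomposables T ⟶ W.indecomposables T' :=
  ModuleCat.ofHom (Submodule.mapQ _ _ (W.map g).hom (W.decomposables_le_comap_map g))

/-- The map `H₀(V)_T → H₀(W)_T` induced by a map of `FI`-modules `V → W`. -/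
def indecomposablesApp {V W : FIMod.{u, v}} (φ : V ⟶ W) (T : FI.{u}) :
    V.indecomposables T ⟶ W.indecomposables T :=
  ModuleCat.ofHom (Submodule.mapQ _ _ (φ.app T).hom (decomposables_le_comap_app φ T))

/-- The `FI`-module `H₀(W)`. -/
def H0obj (W : FIMod.{u, v}) : FIMod.{u, v} where
  obj T := W.indecomposables T
  map g := W.indecomposablesMap g
  map_id T := by
    ext x
    obtain ⟨x, rfl⟩ := Submodule.mkQ_surjective _ x
    simp [indecomposablesMap]
  map_comp f g := by
    ext x
    obtain ⟨x, rfl⟩ := Submodule.mkQ_surjective _ x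
    simp [indecomposablesMap]

/-- The functor `H₀` from `FI`-modules to `FI`-modules. -/
def H0 : FIMod.{u, v} ⥤ FIMod.{u, v} where
  obj W := W.H0obj
  map {V W} φ :=
    { app := fun T => indecomposablesApp φ T
      naturality := by
        intro S T f
        refine ModuleCat.hom_ext (LinearMap.ext fun x => ?_)
        obtain ⟨x, rfl⟩ := (V.decomposables S).mkQ_surjective x
        exact congrArg (W.decomposables T).mkQ (NatTrans.naturality_apply φ f x) }
  map_id W := by
    refine NatTrans.ext (funext fun T => ModuleCat.hom_ext (LinearMap.ext fun x => ?_))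
    obtain ⟨x, rfl⟩ := (W.decomposables T).mkQ_surjective x
    rfl
  map_comp {U V W} φ ψ := by
    refine NatTrans.ext (funext fun T => ModuleCat.hom_ext (LinearMap.ext fun x => ?_))
    obtain ⟨x, rfl⟩ := (U.decomposables T).mkQ_surjective x
    rfl

instance : (H0.{u, v}).Additive where
  map_add {V W φ ψ} := by
    refine NatTrans.ext (funext fun T => ModuleCat.hom_ext (LinearMap.ext fun x => ?_))
    obtain ⟨x, rfl⟩ := (V.decomposables T).mkQ_surjective x
    rfl

/-- The category of `FI`-modules has enough projectives, so left derived functors exist. -/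
instance : EnoughProjectives FIMod.{u, v} where
  presentation W := by
    let L (n : ℕ) := evaluationLeftAdjoint (ModuleCat.{v} ℤ) (FI.std.{u} n)
    let adj (n : ℕ) : L n ⊣ _ := evaluationAdjunctionRight (ModuleCat.{v} ℤ) (FI.std.{u} n)
    let P (n : ℕ) : FIMod.{u, v} := (L n).obj (Projective.over (W.obj (FI.std n)))
    have hP (n : ℕ) : Projective (P n) := (adj n).map_projective _ inferInstance
    let p (n : ℕ) : P n ⟶ W := ((adj n).homEquiv _ W).symm (Projective.π (W.obj (FI.std n)))
    have hp (n : ℕ) : Epi ((p n).app (FI.std n)) := by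
      have h : ((adj n).homEquiv _ W) (p n) = Projective.π (W.obj (FI.std n)) :=
        Equiv.apply_symm_apply _ _
      rw [Adjunction.homEquiv_unit] at h
      have : Epi ((adj n).unit.app (Projective.over (W.obj (FI.std n))) ≫
          ((evaluation _ _).obj (FI.std n)).map (p n)) := by
        rw [h]; exact Projective.π_epi (W.obj (FI.std n))
      exact epi_of_epi ((adj n).unit.app (Projective.over (W.obj (FI.std n))))
        (((evaluation _ _).obj (FI.std n)).map (p n))
    let q : ∐ P ⟶ W := Sigma.desc p
    have h (T : FI.{u}) : Epi (q.app T) := by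
      obtain ⟨e⟩ := T.nonempty_iso_std
      have h1 : Epi (q.app (FI.std T.card)) := by
        have h2 : (Sigma.ι P T.card).app (FI.std T.card) ≫ q.app (FI.std T.card)
            = (p T.card).app (FI.std T.card) := by
          rw [← NatTrans.comp_app, Sigma.ι_desc]
        have := hp T.card
        rw [← h2] at this
        exact epi_of_epi ((Sigma.ι P T.card).app (FI.std T.card)) _
      have h3 : (∐ P).map e.hom ≫ q.app T
          = q.app (FI.std T.card) ≫ W.map e.hom := NatTrans.naturality _ _
      have : Epi ((∐ P).map e.hom ≫ q.app T) := by
        rw [h3]; exact epi_comp _ _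
      exact epi_of_epi ((∐ P).map e.hom) _
    have hq : Projective (∐ P) :=
      ⟨fun f e _ => ⟨Sigma.desc fun n => Projective.factorThru (Sigma.ι P n ≫ f) e,
        Sigma.hom_ext _ _ fun n => by simp⟩⟩
    exact ⟨{ p := ∐ P, projective := hq, f := q, epi := NatTrans.epi_of_epi_app q }⟩

/-- `FI`-homology: `H p` is the `p`-th left derived functor of `H0`. -/
noncomputable def H (p : ℕ) : FIMod.{u, v} ⥤ FIMod.{u, v} := (H0.{u, v}).leftDerived p

/-- The poset, under inclusion, of the subsets of `T` with at most `N` elements. -/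
abbrev SmallSubsets (T : FI.{u}) (N : WithBot ℕ∞) : Type u :=
  {S : Set T.carrier // ((S.encard : ℕ∞) : WithBot ℕ∞) ≤ N}

/-- A subset of at most `N` elements of `T` is a finite set, and an inclusion of such subsets is
an injection. -/
def smallSubsetsFunctor (T : FI.{u}) (N : WithBot ℕ∞) : SmallSubsets T N ⥤ FI.{u} where
  obj S := ⟨S.1⟩
  map {S S'} h := Set.embeddingOfSubset S.1 S'.1 (leOfHom h)

/-- The diagram of the groups `W_S`, where `S` runs over the subsets of `T` with `|S| ≤ N`. -/
def smallSubsetsDiagram (W : FIMod.{u, v}) (T : FI.{u}) (N : WithBot ℕ∞) :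
    SmallSubsets T N ⥤ ModuleCat.{v} ℤ :=
  smallSubsetsFunctor T N ⋙ W

/-- The maps `W_S → W_T` induced by the inclusions of the subsets `S` of `T` with `|S| ≤ N`. -/
def smallSubsetsCocone (W : FIMod.{u, v}) (T : FI.{u}) (N : WithBot ℕ∞) :
    Cocone (W.smallSubsetsDiagram T N) where
  pt := W.obj T
  ι :=
    { app := fun S => W.map
        (show (smallSubsetsFunctor T N).obj S ⟶ T from Function.Embedding.subtype (· ∈ S.1))
      naturality := by
        intro S S' h
        refine Eq.trans ?_ (Category.comp_id _).symm
        exact (W.map_comp _ _).symm }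

/-- The property `W_T = colim W_S` over the subsets `S` of `T` with `|S| ≤ N`: the canonical maps
`W_S → W_T` form a colimit cocone. -/
def IsColimitOfSmallSubsets (W : FIMod.{u, v}) (T : FI.{u}) (N : WithBot ℕ∞) : Prop :=
  Nonempty (IsColimit (W.smallSubsetsCocone T N))

end FIMod


/-!
For every finite set `T` the sequence
`0 ⟶ H₁(W)_T ⟶ colim_{S ⊊ T} W_S ⟶ W_T ⟶ H₀(W)_T ⟶ 0` is exact. Indeed the colimit over the proper
subsets of `T` is a right exact functor of `W`, and its map to `W_T` is injective when `W` is
projective: such a `W` has the lifting property against the functors coinduced along a truncation of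
`FI`, so every compatible family of maps `W_S ⟶ A` comes from a map `W_T ⟶ A`. The sequence is then
the end of a long exact homology sequence over a projective resolution of `W`. Hence `W_T` is
the colimit over the proper subsets of `T` if and only if `H₀(W)` and `H₁(W)` vanish at `T`, and
transitivity of left Kan extensions together with induction on `|T|` shows that `W_T` is the colimit
over the subsets with at most `N` elements for all `T` if and only if this holds for all `T` with
`|T| > N`.
-/

section KanExtension

variable {C : Type*} [Category* C] {D : Type*} [Category* D]

/-- A compatible family of maps `F.obj Y ⟶ A`, one for each morphism `Y ⟶ X` whose source
satisfies `Q`. -/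
structure CompatibleFamily (F : C ⥤ D) (Q : ObjectProperty C) (X : C) (A : D) where
  hom {Y : C} (f : Y ⟶ X) (hY : Q Y) : F.obj Y ⟶ A
  map_hom {Y Z : C} (g : Y ⟶ Z) (f : Z ⟶ X) (hY : Q Y) (hZ : Q Z) :
    F.map g ≫ hom f hZ = hom (g ≫ f) hY

/-- A map out of `F.obj X` extends a compatible family if it restricts to each of its members. -/
def CompatibleFamily.IsExtension {F : C ⥤ D} {Q : ObjectProperty C} {X : C} {A : D}
    (φ : CompatibleFamily F Q X A) (θ : F.obj X ⟶ A) : Prop :=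
  ∀ ⦃Y : C⦄ (f : Y ⟶ X) (hY : Q Y), F.map f ≫ θ = φ.hom f hY

namespace CompatibleFamily

variable {F : C ⥤ D} {Q R : ObjectProperty C} {X Y : C} {A : D}

/-- The family of the restrictions of a map. -/
@[simps]
def ofHom (Q : ObjectProperty C) (θ : F.obj X ⟶ A) : CompatibleFamily F Q X A where
  hom f _ := F.map f ≫ θ
  map_hom g f _ _ := by simp

/-- Restriction to fewer morphisms. -/
@[simps]
def restrict (φ : CompatibleFamily F R X A) (hQR : Q ≤ R) : CompatibleFamily F Q X A where
  hom f hY := φ.hom f (hQR _ hY)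
  map_hom g f hY hZ := φ.map_hom g f (hQR _ hY) (hQR _ hZ)

/-- Composition with a morphism of the base. -/
@[simps]
def pullback (φ : CompatibleFamily F Q X A) (e : Y ⟶ X) : CompatibleFamily F Q Y A where
  hom f hZ := φ.hom (f ≫ e) hZ
  map_hom g f hZ hW := by rw [φ.map_hom g (f ≫ e) hZ hW, Category.assoc]

end CompatibleFamily

/-- `F` is, at `X`, the pointwise left Kan extension of its restriction to the objects satisfying
`Q`. -/
def IsExtendedFrom (F : C ⥤ D) (Q : ObjectProperty C) (X : C) : Prop :=
  ∀ ⦃A : D⦄ (φ : CompatibleFamily F Q X A), ∃! θ : F.obj X ⟶ A, φ.IsExtension θ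

variable {F : C ⥤ D} {Q R : ObjectProperty C} {X Y : C}

lemma IsExtendedFrom.hom_ext (h : IsExtendedFrom F Q X) {A : D} {θ θ' : F.obj X ⟶ A}
    (H : ∀ ⦃Y : C⦄ (f : Y ⟶ X), Q Y → F.map f ≫ θ = F.map f ≫ θ') : θ = θ' :=
  (h (.ofHom Q θ')).unique (fun _ f hY => H f hY) fun _ _ _ => rfl

lemma isExtendedFrom_of_prop (hX : Q X) : IsExtendedFrom F Q X := fun _ φ =>
  ⟨φ.hom (𝟙 X) hX, fun _ f hY => by rw [φ.map_hom f _ hY, Category.comp_id],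
    fun θ hθ => by rw [← hθ (𝟙 X) hX, F.map_id, Category.id_comp]⟩

/-- Transitivity of pointwise left Kan extensions. -/
lemma isExtendedFrom_iff_of_le (hQR : Q ≤ R) (hR : ∀ ⦃Y : C⦄, R Y → IsExtendedFrom F Q Y) :
    IsExtendedFrom F Q X ↔ IsExtendedFrom F R X := by
  constructor
  · intro h A φ
    obtain ⟨θ, hθ, uniq⟩ := h (φ.restrict hQR)
    refine ⟨θ, fun Y f hY => (hR hY).hom_ext fun Z g hZ => ?_,
      fun θ' hθ' => uniq θ' fun Y f hY => hθ' f (hQR _ hY)⟩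
    rw [← F.map_comp_assoc, hθ _ hZ, φ.map_hom g f (hQR _ hZ) hY, φ.restrict_hom]
  · intro h A φ
    choose ψ hψ using fun {Y : C} (f : Y ⟶ X) (hY : R Y) => (hR hY (φ.pullback f)).exists
    let Ψ : CompatibleFamily F R X A :=
      { hom := ψ
        map_hom g f hY hZ := (hR hY).hom_ext fun W e hW => by
          rw [← F.map_comp_assoc, hψ f hZ (e ≫ g) hW, hψ (g ≫ f) hY e hW]
          simp }
    obtain ⟨θ, hθ, uniq⟩ := h Ψ
    refine ⟨θ, fun Z f hZ => ?_,
      fun θ' hθ' => uniq θ' fun Y f hY => (hR hY).hom_ext fun Z g hZ => ?_⟩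
    · have := hψ f (hQR _ hZ) (𝟙 Z) hZ
      rw [hθ f (hQR _ hZ)]
      simpa using this
    · rw [← F.map_comp_assoc, hθ' _ hZ, hψ f hY g hZ, φ.pullback_hom]

end KanExtension

section Coinduced

variable {C : Type*} [Category* C] [∀ X Y : C, Finite (X ⟶ Y)]
  {D : Type*} [Category* D] [HasFiniteProducts D]

/-- The functor `U ↦ ∏ᶜ A`, the product being over the morphisms `U ⟶ X` if `U` satisfies `Q` and
empty otherwise. Maps `F ⟶ coinduced Q hQ X A` correspond to compatible families
`CompatibleFamily F Q X A`. -/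
noncomputable def coinduced (Q : ObjectProperty C) (hQ : ∀ ⦃U V : C⦄, (U ⟶ V) → Q V → Q U)
    (X : C) (A : D) : C ⥤ D where
  obj U := ∏ᶜ fun _ : {_f : U ⟶ X // Q U} => A
  map {U V} g := Pi.lift fun f : {_f : V ⟶ X // Q V} =>
    Pi.π (fun _ : {_f : U ⟶ X // Q U} => A) ⟨g ≫ f.1, hQ g f.2⟩
  map_id U := Pi.hom_ext _ _ fun f => by simp
  map_comp f g := Pi.hom_ext _ _ fun f => by simp

namespace coinduced

variable {Q : ObjectProperty C} {hQ : ∀ ⦃U V : C⦄, (U ⟶ V) → Q V → Q U} {X U V : C} {A B : D}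

/-- The projection of the coinduced functor to the factor of a morphism. -/
noncomputable def π (f : U ⟶ X) (hU : Q U) : (coinduced Q hQ X A).obj U ⟶ A :=
  Pi.π (fun _ : {_f : U ⟶ X // Q U} => A) ⟨f, hU⟩

/-- The map to the coinduced functor with given components. -/
noncomputable def lift (φ : ∀ _ : U ⟶ X, Q U → (B ⟶ A)) : B ⟶ (coinduced Q hQ X A).obj U :=
  Pi.lift fun f : {_f : U ⟶ X // Q U} => φ f.1 f.2

lemma hom_ext {φ ψ : B ⟶ (coinduced Q hQ X A).obj U} (H : ∀ f hU, φ ≫ π f hU = ψ ≫ π f hU) :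
    φ = ψ :=
  Pi.hom_ext _ _ fun f => H f.1 f.2

@[simp]
lemma lift_π (φ : ∀ _ : U ⟶ X, Q U → (B ⟶ A)) (f : U ⟶ X) (hU : Q U) :
    lift (hQ := hQ) φ ≫ π f hU = φ f hU :=
  Pi.lift_π _ _

@[simp]
lemma map_π (g : U ⟶ V) (f : V ⟶ X) (hV : Q V) :
    (coinduced Q hQ X A).map g ≫ π f hV = π (g ≫ f) (hQ g hV) :=
  Pi.lift_π _ _

/-- The projection that forgets the factors at the objects which do not satisfy `Q`. -/
noncomputable def restrict (Q : ObjectProperty C) (hQ : ∀ ⦃U V : C⦄, (U ⟶ V) → Q V → Q U)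
    (X : C) (A : D) : coinduced ⊤ (fun _ _ _ h => h) X A ⟶ coinduced Q hQ X A where
  app U := lift fun f _ => π f trivial
  naturality U V g := hom_ext fun f hV => by simp only [Category.assoc, lift_π, map_π]

instance [HasZeroMorphisms D] : Epi (restrict Q hQ X A) := by
  have (U : C) : IsSplitEpi ((restrict Q hQ X A).app U) := by
    by_cases hU : Q U
    · exact ⟨⟨lift fun f _ => π f hU, hom_ext fun f _ => by simp [restrict, lift_π]⟩⟩
    · exact ⟨⟨0, hom_ext fun f hU' => absurd hU' hU⟩⟩
  exact NatTrans.epi_of_epi_app _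

end coinduced

namespace CompatibleFamily

variable {F : C ⥤ D} {Q : ObjectProperty C} {X : C} {A : D}

/-- The map to the coinduced functor attached to a compatible family. -/
noncomputable def toCoinduced (φ : CompatibleFamily F Q X A)
    (hQ : ∀ ⦃U V : C⦄, (U ⟶ V) → Q V → Q U) : F ⟶ coinduced Q hQ X A where
  app U := coinduced.lift fun f hU => φ.hom f hU
  naturality U V g := coinduced.hom_ext fun f hV => by
    simp only [Category.assoc, coinduced.lift_π, coinduced.map_π]
    exact φ.map_hom g f _ hV

lemma exists_isExtension_of_projective [HasZeroMorphisms D] [Projective F]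
    (φ : CompatibleFamily F Q X A) (hQ : ∀ ⦃U V : C⦄, (U ⟶ V) → Q V → Q U) :
    ∃ θ : F.obj X ⟶ A, φ.IsExtension θ := by
  let ψ := Projective.factorThru (φ.toCoinduced hQ) (coinduced.restrict Q hQ X A)
  have hψ : ψ ≫ coinduced.restrict Q hQ X A = φ.toCoinduced hQ := Projective.factorThru_comp _ _
  refine ⟨ψ.app X ≫ coinduced.π (𝟙 X) trivial, fun U f hU => ?_⟩
  have hU' : ψ.app U ≫ coinduced.π f trivial = φ.hom f hU := by
    simpa [coinduced.restrict, toCoinduced] using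
      congrArg (fun η => η.app U ≫ coinduced.π f hU) hψ
  rw [← hU', ψ.naturality_assoc, coinduced.map_π, Category.comp_id]

end CompatibleFamily

end Coinduced

section Derived

variable {A : Type*} [Category* A] [Abelian A] {B : Type*} [Category* B] [Abelian B]

lemma isZero_homology_map_succ {X : A} (P : ProjectiveResolution X) (G : A ⥤ B) [G.Additive]
    [PreservesFiniteLimits G] [PreservesFiniteColimits G] (n : ℕ) :
    IsZero (((G.mapHomologicalComplex _).obj P.complex).homology (n + 1)) := by
  rw [← HomologicalComplex.exactAt_iff_isZero_homology]
  exact (P.complex_exactAt_succ n).map G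

lemma opcyclesMap_comp_fromLeftDerivedZero' {X : A} (P : ProjectiveResolution X) {F G : A ⥤ B}
    [F.Additive] [G.Additive] (α : F ⟶ G) :
    HomologicalComplex.opcyclesMap ((NatTrans.mapHomologicalComplex α _).app P.complex) 0 ≫
      P.fromLeftDerivedZero' G = P.fromLeftDerivedZero' F ≫ α.app X := by
  rw [← cancel_epi (HomologicalComplex.pOpcycles _ _),
    HomologicalComplex.p_opcyclesMap_assoc, P.pOpcycles_comp_fromLeftDerivedZero' G,
    ← Category.assoc]
  exact (α.naturality _).symm.trans
    (congrArg (· ≫ α.app X) (P.pOpcycles_comp_fromLeftDerivedZero' F).symm)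

lemma mono_homologyMap_zero_iff {X : A} (P : ProjectiveResolution X) {F G : A ⥤ B}
    [F.Additive] [G.Additive] [PreservesFiniteColimits F] [PreservesFiniteColimits G]
    (α : F ⟶ G) :
    Mono (HomologicalComplex.homologyMap ((NatTrans.mapHomologicalComplex α _).app P.complex) 0) ↔
      Mono (α.app X) := by
  let e (F : A ⥤ B) [F.Additive] [PreservesFiniteColimits F] :
      ((F.mapHomologicalComplex (ComplexShape.down ℕ)).obj P.complex).homology 0 ≅ F.obj X :=
    ChainComplex.isoHomologyι₀ _ ≪≫ asIso (P.fromLeftDerivedZero' F)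
  refine (MorphismProperty.monomorphisms B).arrow_mk_iso_iff (Arrow.isoMk (e F) (e G) ?_)
  change ((ChainComplex.isoHomologyι₀ _).hom ≫ P.fromLeftDerivedZero' F) ≫ α.app X =
    _ ≫ (ChainComplex.isoHomologyι₀ _).hom ≫ P.fromLeftDerivedZero' G
  rw [Category.assoc, ← opcyclesMap_comp_fromLeftDerivedZero']
  exact (HomologicalComplex.homologyι_naturality_assoc _ 0 _).symm

variable {S : ShortComplex (A ⥤ B)}

/-- The complex of chain complexes obtained by applying `S` to each object of `K`. -/
abbrev mapChainComplex (S : ShortComplex (A ⥤ B)) [S.X₁.Additive] [S.X₂.Additive] [S.X₃.Additive]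
    (K : ChainComplex A ℕ) : ShortComplex (ChainComplex B ℕ) where
  X₁ := (S.X₁.mapHomologicalComplex _).obj K
  X₂ := (S.X₂.mapHomologicalComplex _).obj K
  X₃ := (S.X₃.mapHomologicalComplex _).obj K
  f := (NatTrans.mapHomologicalComplex S.f _).app K
  g := (NatTrans.mapHomologicalComplex S.g _).app K
  zero := by
    ext i
    exact congrArg (fun α => α.app (K.X i)) S.zero

lemma isZero_leftDerived_one_iff [EnoughProjectives A] [S.X₁.Additive] [S.X₂.Additive]
    [S.X₃.Additive] [PreservesFiniteColimits S.X₁] [PreservesFiniteLimits S.X₂]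
    [PreservesFiniteColimits S.X₂] (hS : ∀ X, (S.map ((evaluation A B).obj X)).Exact)
    (hg : ∀ X, Epi (S.g.app X)) (hP : ∀ (P : A) [Projective P], Mono (S.f.app P)) (X : A) :
    IsZero ((S.X₃.leftDerived 1).obj X) ↔ Mono (S.f.app X) := by
  let P := projectiveResolution X
  have hK : (mapChainComplex S P.complex).ShortExact :=
    HomologicalComplex.shortExact_of_degreewise_shortExact _ fun i =>
      { exact := hS _
        mono_f := hP _
        epi_g := hg _ }
  have hδ : Mono (hK.δ 1 0 rfl) := hK.mono_δ 1 0 rfl (isZero_homology_map_succ P S.X₂ 0)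
  have hδ_eq : IsZero ((mapChainComplex S P.complex).X₃.homology 1) ↔ hK.δ 1 0 rfl = 0 :=
    ⟨fun h => h.eq_of_src _ _, IsZero.of_mono_eq_zero _⟩
  rw [(P.isoLeftDerivedObj S.X₃ 1).isZero_iff, ← mono_homologyMap_zero_iff P S.f]
  exact hδ_eq.trans (hK.homology_exact₁ 1 0 rfl).mono_g_iff.symm

lemma isIso_app_iff_isZero_leftDerived [EnoughProjectives A] [S.X₁.Additive] [S.X₂.Additive]
    [S.X₃.Additive] [PreservesFiniteColimits S.X₁] [PreservesFiniteLimits S.X₂]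
    [PreservesFiniteColimits S.X₂] (hS : ∀ X, (S.map ((evaluation A B).obj X)).Exact)
    (hg : ∀ X, Epi (S.g.app X)) (hP : ∀ (P : A) [Projective P], Mono (S.f.app P)) (X : A) :
    IsIso (S.f.app X) ↔ IsZero (S.X₃.obj X) ∧ IsZero ((S.X₃.leftDerived 1).obj X) := by
  have hg_eq : IsZero (S.X₃.obj X) ↔ S.g.app X = 0 :=
    ⟨fun h => h.eq_of_tgt _ _, fun h => have := hg X; IsZero.of_epi_eq_zero _ h⟩
  rw [isIso_iff_mono_and_epi, isZero_leftDerived_one_iff hS hg hP, and_comm, hg_eq]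
  exact and_congr_left' (hS X).epi_f_iff

/-- Left derived functors commute with an exact functor applied to the values. -/
noncomputable def leftDerivedCompIso [EnoughProjectives A] {E : Type*} [Category* E] [Abelian E]
    (F : A ⥤ B) [F.Additive] (G : B ⥤ E) [G.Additive] [PreservesFiniteLimits G]
    [PreservesFiniteColimits G] (n : ℕ) (X : A) :
    ((F ⋙ G).leftDerived n).obj X ≅ G.obj ((F.leftDerived n).obj X) :=
  let P := projectiveResolution X
  let K := (F.mapHomologicalComplex (ComplexShape.down ℕ)).obj P.complex
  P.isoLeftDerivedObj (F ⋙ G) n ≪≫ (K.sc n).mapHomologyIso G ≪≫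
    G.mapIso (P.isoLeftDerivedObj F n).symm

end Derived

namespace FI

/-- The subsets of `T` satisfying `Q`, ordered by inclusion. -/
abbrev Subsets (Q : ObjectProperty FI.{u}) (T : FI.{u}) : Type u :=
  {S : Set T.carrier // Q ⟨S⟩}

noncomputable instance (Q : ObjectProperty FI.{u}) (T : FI.{u}) : FinCategory (Subsets Q T) :=
  have := Fintype.ofFinite (Subsets Q T)
  inferInstance

/-- `FIMod.smallSubsetsFunctor` for an arbitrary class of finite sets. -/
abbrev subsetsFunctor (Q : ObjectProperty FI.{u}) (T : FI.{u}) : Subsets Q T ⥤ FI.{u} where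
  obj S := ⟨S.1⟩
  map {S S'} h := Set.embeddingOfSubset S.1 S'.1 (leOfHom h)

/-- The inclusion of a subset. -/
def subsetInclusion {T : FI.{u}} (S : Set T.carrier) : (⟨S⟩ : FI.{u}) ⟶ T :=
  Function.Embedding.subtype (· ∈ S)

/-- The image of an injection. -/
def range {S T : FI.{u}} (f : S ⟶ T) : Set T.carrier :=
  Set.range (show S.carrier ↪ T.carrier from f)

/-- An injection as a bijection onto its image. -/
noncomputable def isoRange {S T : FI.{u}} (f : S ⟶ T) : S ≅ (⟨range f⟩ : FI.{u}) :=
  let e := Equiv.ofInjective _ (show S.carrier ↪ T.carrier from f).injective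
  { hom := e.toEmbedding
    inv := e.symm.toEmbedding
    hom_inv_id := Function.Embedding.ext fun x => e.symm_apply_apply x
    inv_hom_id := Function.Embedding.ext fun x => e.apply_symm_apply x }

lemma isoRange_hom_comp_subsetInclusion {S T : FI.{u}} (f : S ⟶ T) :
    (isoRange f).hom ≫ subsetInclusion (range f) = f :=
  rfl

variable {Q : ObjectProperty FI.{u}}

lemma range_comp_subset {S S' T : FI.{u}} (g : S ⟶ S') (f : S' ⟶ T) :
    range (g ≫ f) ⊆ range f :=
  Set.range_comp_subset_range (show S.carrier ↪ S'.carrier from g)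
    (show S'.carrier ↪ T.carrier from f)

variable [Q.IsClosedUnderIsomorphisms]

/-- The image of an injection whose source satisfies `Q`. -/
abbrev rangeSubset {S T : FI.{u}} (f : S ⟶ T) (hS : Q S) : Subsets Q T :=
  ⟨range f, Q.prop_of_iso (isoRange f) hS⟩

lemma isoRange_comp {S S' T : FI.{u}} (g : S ⟶ S') (f : S' ⟶ T) (hS : Q S) (hS' : Q S') :
    (isoRange (g ≫ f)).hom ≫ (subsetsFunctor Q T).map
      (homOfLE (range_comp_subset g f) : rangeSubset (g ≫ f) hS ⟶ rangeSubset f hS') =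
        g ≫ (isoRange f).hom :=
  rfl

lemma isoRange_subsetInclusion {T : FI.{u}} (S : Subsets Q T) :
    (isoRange (subsetInclusion S.1)).hom = (subsetsFunctor Q T).map
      (homOfLE (Subtype.range_coe.ge) : S ⟶ rangeSubset (subsetInclusion S.1) S.2) :=
  rfl

end FI

section Subsets

variable {D : Type*} [Category* D]

/-- `FIMod.smallSubsetsCocone` for an arbitrary class of finite sets. -/
abbrev subsetsCocone (W : FI.{u} ⥤ D) (Q : ObjectProperty FI.{u}) (T : FI.{u}) :
    Cocone (FI.subsetsFunctor Q T ⋙ W) where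
  pt := W.obj T
  ι :=
    { app S := W.map (FI.subsetInclusion S.1)
      naturality _ _ _ := (W.map_comp _ _).symm.trans (Category.comp_id _).symm }

variable {W : FI.{u} ⥤ D} {Q : ObjectProperty FI.{u}} {T : FI.{u}}

/-- A compatible family restricts to a cocone under the subsets. -/
abbrev CompatibleFamily.toCocone {A : D} (φ : CompatibleFamily W Q T A) :
    Cocone (FI.subsetsFunctor Q T ⋙ W) where
  pt := A
  ι :=
    { app S := φ.hom (FI.subsetInclusion S.1) S.2
      naturality S S' _ := (φ.map_hom _ _ S.2 S'.2).trans (Category.comp_id _).symm }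

variable [Q.IsClosedUnderIsomorphisms]

/-- A cocone under the subsets extends to a compatible family. -/
noncomputable abbrev CompatibleFamily.ofCocone (s : Cocone (FI.subsetsFunctor Q T ⋙ W)) :
    CompatibleFamily W Q T s.pt where
  hom f hS := W.map (FI.isoRange f).hom ≫ s.ι.app (FI.rangeSubset f hS)
  map_hom g f hS hS' := by
    rw [← s.w (homOfLE (FI.range_comp_subset g f) :
      FI.rangeSubset (g ≫ f) hS ⟶ FI.rangeSubset f hS'), ← W.map_comp_assoc,
      ← FI.isoRange_comp g f hS hS', W.map_comp_assoc]
    rfl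

lemma CompatibleFamily.toCocone_ofCocone_app (s : Cocone (FI.subsetsFunctor Q T ⋙ W))
    (S : FI.Subsets Q T) : (ofCocone s).toCocone.ι.app S = s.ι.app S := by
  dsimp only
  rw [FI.isoRange_subsetInclusion]
  exact s.w _

lemma CompatibleFamily.isExtension_iff_toCocone {A : D} (φ : CompatibleFamily W Q T A)
    (θ : W.obj T ⟶ A) :
    φ.IsExtension θ ↔ ∀ S, (subsetsCocone W Q T).ι.app S ≫ θ = φ.toCocone.ι.app S := by
  refine ⟨fun h S => h _ S.2, fun h S f hS => ?_⟩
  have hf := h (FI.rangeSubset f hS)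
  calc W.map f ≫ θ
      = W.map (FI.isoRange f).hom ≫ W.map (FI.subsetInclusion (FI.range f)) ≫ θ := by
        rw [← W.map_comp_assoc, FI.isoRange_hom_comp_subsetInclusion]
    _ = W.map (FI.isoRange f).hom ≫ φ.hom (FI.subsetInclusion (FI.range f)) _ :=
        congrArg (W.map (FI.isoRange f).hom ≫ ·) hf
    _ = φ.hom f hS := φ.map_hom _ _ hS _

theorem nonempty_isColimit_subsetsCocone_iff :
    Nonempty (IsColimit (subsetsCocone W Q T)) ↔ IsExtendedFrom W Q T := by
  constructor
  · rintro ⟨hc⟩ A φ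
    simpa only [φ.isExtension_iff_toCocone] using hc.existsUnique φ.toCocone
  · refine fun h => ⟨.ofExistsUnique fun s => ?_⟩
    refine (existsUnique_congr fun θ => ?_).1 (h (.ofCocone s))
    rw [CompatibleFamily.isExtension_iff_toCocone]
    exact forall_congr' fun S => by rw [CompatibleFamily.toCocone_ofCocone_app]

end Subsets

namespace FI

/-- The finite sets with at most `N` elements. The cardinality is taken in `ℕ∞` so that
`subsetsCocone W (cardLE N) T` unfolds to `W.smallSubsetsCocone T N`. -/
def cardLE (N : WithBot ℕ∞) : ObjectProperty FI.{u} := fun S =>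
  ((ENat.card S.carrier : ℕ∞) : WithBot ℕ∞) ≤ N

/-- The finite sets with fewer than `n` elements. -/
def cardLT (n : ℕ) : ObjectProperty FI.{u} := fun S => S.card < n

lemma cardLE_iff {N : WithBot ℕ∞} {T : FI.{u}} : cardLE N T ↔ (T.card : WithBot ℕ∞) ≤ N := by
  rw [cardLE, ENat.card_eq_coe_natCard]
  rfl

lemma cardLE.of_hom {N : WithBot ℕ∞} {S T : FI.{u}} (f : S ⟶ T) (hT : cardLE N T) : cardLE N S :=
  le_trans (mod_cast ENat.card_le_card_of_injective (Function.Embedding.injective f)) hT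

lemma cardLT.of_hom {n : ℕ} {S T : FI.{u}} (f : S ⟶ T) (hT : cardLT n T) : cardLT n S :=
  (card_le_of_hom f).trans_lt hT

instance (N : WithBot ℕ∞) : (cardLE.{u} N).IsClosedUnderIsomorphisms :=
  ⟨fun e h => h.of_hom e.inv⟩

instance (n : ℕ) : (cardLT.{u} n).IsClosedUnderIsomorphisms :=
  ⟨fun e h => h.of_hom e.inv⟩

lemma cardLE_le_cardLT {N : WithBot ℕ∞} {T : FI.{u}} (hT : ¬ cardLE N T) :
    cardLE N ≤ cardLT.{u} T.card := fun S hS => by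
  rw [cardLE_iff] at hT hS
  exact_mod_cast hS.trans_lt (not_le.1 hT)

theorem forall_isExtendedFrom_cardLE_iff {D : Type*} [Category* D] {W : FI.{u} ⥤ D}
    {N : WithBot ℕ∞} :
    (∀ T, IsExtendedFrom W (cardLE N) T) ↔
      ∀ T, ¬ cardLE N T → IsExtendedFrom W (cardLT T.card) T := by
  refine ⟨fun h T hT => (isExtendedFrom_iff_of_le (cardLE_le_cardLT hT) fun S _ => h S).1 (h T),
    fun h T => ?_⟩
  induction hn : T.card using Nat.strong_induction_on generalizing T with
  | _ n ih =>
    subst hn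
    by_cases hT : cardLE N T
    · exact isExtendedFrom_of_prop hT
    · exact (isExtendedFrom_iff_of_le (cardLE_le_cardLT hT) fun S hS => ih S.card hS S rfl).2
        (h T hT)

end FI

section Latching

variable {D : Type*} [Category* D] [HasFiniteColimits D]

variable (D) in
/-- The functor `W ↦ colim W_S`, where `S` runs over the proper subsets of `T`. -/
noncomputable abbrev latching (T : FI.{u}) : (FI.{u} ⥤ D) ⥤ D :=
  (Functor.whiskeringLeft _ _ _).obj (FI.subsetsFunctor (FI.cardLT T.card) T) ⋙ colim

variable (D) in
/-- The canonical map from the colimit of the `W_S`, for `S` a proper subset of `T`, to `W_T`. -/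
noncomputable abbrev latchingMap (T : FI.{u}) : latching D T ⟶ (evaluation _ D).obj T where
  app W := colimit.desc _ (subsetsCocone W (FI.cardLT T.card) T)
  naturality V W α := colimit.hom_ext fun S => by simp

lemma map_eq_comp_latchingMap_app {S T : FI.{u}} (f : S ⟶ T) (hS : FI.cardLT T.card S)
    (W : FI.{u} ⥤ D) :
    W.map f = (W.map (FI.isoRange f).hom ≫ colimit.ι (FI.subsetsFunctor _ T ⋙ W)
      (FI.rangeSubset f hS)) ≫ (latchingMap D T).app W := by
  rw [Category.assoc, colimit.ι_desc]
  exact W.map_comp (FI.isoRange f).hom (FI.subsetInclusion (FI.range f))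

lemma isIso_latchingMap_app_iff (T : FI.{u}) (W : FI.{u} ⥤ D) :
    IsIso ((latchingMap D T).app W) ↔ IsExtendedFrom W (FI.cardLT T.card) T := by
  rw [← nonempty_isColimit_subsetsCocone_iff]
  exact (colimit.isColimit _).nonempty_isColimit_iff_isIso_desc.symm

lemma isSplitMono_latchingMap_app_of_projective [HasFiniteProducts D] [HasZeroMorphisms D]
    (T : FI.{u}) (P : FI.{u} ⥤ D) [Projective P] : IsSplitMono ((latchingMap D T).app P) := by
  let c := colimit.cocone (FI.subsetsFunctor (FI.cardLT T.card) T ⋙ P)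
  obtain ⟨r, hr⟩ :=
    (CompatibleFamily.ofCocone c).exists_isExtension_of_projective fun _ _ => FI.cardLT.of_hom
  rw [CompatibleFamily.isExtension_iff_toCocone] at hr
  refine ⟨⟨r, colimit.hom_ext fun S => ?_⟩⟩
  simpa [c] using (hr S).trans (CompatibleFamily.toCocone_ofCocone_app c S)

end Latching

/-- `AddMonoidHom.toIntLinearMap` for arbitrary `ℤ`-module structures: that of
`FIMod.indecomposables` is not definitionally the quotient module structure. -/
def intLinearMap {M N : Type*} [AddCommGroup M] [AddCommGroup N] [Module ℤ M] [Module ℤ N]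
    (f : M →+ N) : M →ₗ[ℤ] N where
  toFun := f
  map_add' := map_add f
  map_smul' n x := map_intCast_smul f ℤ ℤ n x

namespace FIMod

/-- The projection `W_T ⟶ H₀(W)_T`. -/
def toH0 (T : FI.{u}) :
    (evaluation _ (ModuleCat.{v} ℤ)).obj T ⟶ H0.{u, v} ⋙ (evaluation _ _).obj T where
  app W := ModuleCat.ofHom (Y := indecomposables W T)
    (intLinearMap (decomposables W T).mkQ.toAddMonoidHom)
  naturality _ _ _ := rfl

lemma toH0_app_surjective (T : FI.{u}) (W : FIMod.{u, v}) :
    Function.Surjective ((toH0 T).app W).hom :=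
  (decomposables W T).mkQ_surjective

instance (T : FI.{u}) (W : FIMod.{u, v}) : Epi ((toH0 T).app W) :=
  (ModuleCat.epi_iff_surjective _).2 (toH0_app_surjective T W)

lemma ker_toH0_app (T : FI.{u}) (W : FIMod.{u, v}) :
    LinearMap.ker ((toH0 T).app W).hom = W.decomposables T :=
  Submodule.ext fun _ => Submodule.Quotient.mk_eq_zero _

lemma map_comp_toH0 (W : FIMod.{u, v}) {S T : FI.{u}} (f : S ⟶ T) (h : S.card < T.card) :
    W.map f ≫ (toH0 T).app W = 0 :=
  have range_le : LinearMap.range (W.map f).hom ≤ decomposables W T :=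
    le_iSup₂_of_le S f (le_iSup_of_le h le_rfl)
  ModuleCat.hom_ext (LinearMap.range_le_ker_iff.1 (range_le.trans (ker_toH0_app T W).ge))

/-- The sequence `colim W_S ⟶ W_T ⟶ H₀(W)_T`, with `S` running over the proper subsets of `T`, as
a sequence of functors in `W`. -/
noncomputable abbrev latchingComplex (T : FI.{u}) :
    ShortComplex (FIMod.{u, v} ⥤ ModuleCat.{v} ℤ) where
  f := latchingMap _ T
  g := toH0 T
  zero := by
    ext W : 2
    exact colimit.hom_ext fun S => by simpa using map_comp_toH0 W _ S.2

lemma latchingComplex_exact (T : FI.{u}) (W : FIMod.{u, v}) :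
    ((latchingComplex T).map ((evaluation _ _).obj W)).Exact := by
  refine (ShortComplex.moduleCat_exact_iff_ker_sub_range _).2 <|
    (ker_toH0_app T W).trans_le <| iSup_le fun S => iSup₂_le fun f hS => ?_
  rw [map_eq_comp_latchingMap_app f hS W]
  exact LinearMap.range_comp_le_range _ _

instance (T : FI.{u}) : (latching (ModuleCat.{v} ℤ) T).Additive where
  map_add := colimit.hom_ext fun S => by simp

theorem isExtendedFrom_cardLT_iff (W : FIMod.{u, v}) (T : FI.{u}) :
    IsExtendedFrom W (FI.cardLT T.card) T ↔
      IsZero ((H0.obj W).obj T) ∧ IsZero (((H 1).obj W).obj T) := by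
  have hP (P : FIMod.{u, v}) [Projective P] : Mono ((latchingMap (ModuleCat.{v} ℤ) T).app P) :=
    have := isSplitMono_latchingMap_app_of_projective T P
    inferInstance
  rw [← isIso_latchingMap_app_iff]
  exact (isIso_app_iff_isZero_leftDerived (S := latchingComplex T) (latchingComplex_exact T)
    (fun W => inferInstanceAs (Epi ((toH0 T).app W))) hP W).trans
      (and_congr_right' (leftDerivedCompIso H0 ((evaluation _ _).obj T) 1 W).isZero_iff)

theorem isColimitOfSmallSubsets_iff (W : FIMod.{u, v}) (T : FI.{u}) (N : WithBot ℕ∞) :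
    W.IsColimitOfSmallSubsets T N ↔ IsExtendedFrom W (FI.cardLE N) T :=
  nonempty_isColimit_subsetsCocone_iff (W := W) (Q := FI.cardLE N) (T := T)

lemma deg_le_iff (W : FIMod.{u, v}) (N : WithBot ℕ∞) :
    W.deg ≤ N ↔ ∀ T : FI.{u}, ¬ FI.cardLE N T → IsZero (W.obj T) := by
  have hmem : W.deg ∈ {k : WithBot ℕ∞ | ∀ n : ℕ, k < (n : WithBot ℕ∞) →
      IsZero (W.obj (FI.std n))} :=
    csInf_mem ⟨⊤, fun n hn => absurd hn not_top_lt⟩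
  constructor
  · intro h T hT
    obtain ⟨e⟩ := T.nonempty_iso_std
    rw [FI.cardLE_iff] at hT
    exact (hmem T.card (h.trans_lt (not_le.1 hT))).of_iso (W.mapIso e).symm
  · intro h
    refine csInf_le (OrderBot.bddBelow _) fun n hn => h _ ?_
    have card_std : (FI.std.{u} n).card = n := by simp [FI.card, FI.std]
    rw [FI.cardLE_iff, card_std]
    exact not_le.2 hn

theorem forall_isColimitOfSmallSubsets_iff (W : FIMod.{u, v}) (N : WithBot ℕ∞) :
    (∀ T : FI.{u}, W.IsColimitOfSmallSubsets T N) ↔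
      max (deg (H0.obj W)) (deg ((H 1).obj W)) ≤ N := by
  simp only [isColimitOfSmallSubsets_iff, FI.forall_isExtendedFrom_cardLE_iff,
    isExtendedFrom_cardLT_iff, max_le_iff, deg_le_iff, imp_and, forall_and]

end FIMod

theorem theoremC (W : FIMod.{u, v}) (N : WithBot ℕ∞)
    (hN : N = max (FIMod.deg (FIMod.H0.obj W)) (FIMod.deg ((FIMod.H 1).obj W))) :
    (∀ T : FI.{u}, W.IsColimitOfSmallSubsets T N) ∧
      ∀ K : WithBot ℕ∞, (∀ T : FI.{u}, W.IsColimitOfSmallSubsets T K) → N ≤ K :=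
  ⟨(W.forall_isColimitOfSmallSubsets_iff N).2 hN.ge,
    fun K hK => hN.trans_le ((W.forall_isColimitOfSmallSubsets_iff K).1 hK)⟩
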